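/- Let $\lambda>1/2$ and $\delta\in(0,\min\{\lambda-1/2,1\})$. There is a constant $\tilde C_{\lambda,\delta}>0$, depending only on $\lambda$ and $\delta$, such that the following holds. Let $d\in\mathbb N$, $\alpha>\lambda$, and let $\gamma=(\gamma_u)_{u\subseteq\{1,\dots,d\}}$ be weights with $0<\gamma_u\le 1$. For $h\in\mathbb Z^d$ let $\mathrm{supp}(h)=\{j:h_j\ne0\}$ and $$r_{d,\alpha,\gamma}(h)=\gamma_{\mathrm{supp}(h)}^{-1}\prod_{j\in\mathrm{supp}(h)}|h_j|^{\alpha},\qquad V_d(\alpha,\gamma)=\sum_{h\in\mathbb Z^d\setminus\{0\}}\frac1{r_{d,\alpha,\gamma}(h)}.$$ Put $V:=V_d(\alpha/\lambda,\gamma^{1/\lambda})$, where $\gamma^{1/\lambda}=(\gamma_u^{1/\lambda})_u$. Let $f:[0,1]^d\to\mathbb C$ belong to the weighted Korobov class $\mathcal H_{d,\alpha,\gamma}$, that is, $f(x)=\sum_{h\in\mathbb Z^d}\hat f(h)\,e^{2\pi i h\cdot x}$ on $[0,1]^d$ with an absolutely convergent Fourier series, where $\hat f(h)=\int_{[0,1]^d}f(x)e^{-2\pi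 i h\cdot x}\,dx$, and $$\|f\|_{d,\alpha,\gamma}:=\Big(\sum_{h\in\mathbb Z^d}r_{d,\alpha,\gamma}(h)^2|\hat f(h)|^2\Big)^{1/2}<\infty.$$ Let $I_d(f)=\int_{[0,1]^d}f(x)\,dx$ and, for a prime $p$ and $z\in\{1,\dots,p-1\}^d$, let $$Q_p^z(f)=\frac1p\sum_{k=0}^{p-1}f\left(\left\{\frac{kz}{p}\right\}\right),$$ where $\{\cdot\}$ is the entry-wise fractional part. Let $n\ge2$ be an integer with $n\ge 64\,V$, let $p$ be uniformly distributed on the set $\mathcal P_n$ of primes $p$ with $\lceil n/2\rceil+1\le p\le n$, and, given $p$, let $z$ be uniformly distributed on $\{1,\dots,p-1\}^d$. Then, with probability at least $7/8$, $$\left|I_d(f)-Q_p^z(f)\right|\le 16\,\tilde C_{\lambda,\delta}\,V^{\lambda}\,n^{-\lambda-1/2+\delta}\,\|f\|_{d,\alpha,\gamma}.$$ -/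

import Mathlib

noncomputable section

/-- `{1 : p - 1}^d`, the set of all generating vectors modulo `p`. -/
def generatingVectors (d p : ℕ) : Finset (Fin d → ℕ) :=
  Fintype.piFinset fun _ => Finset.Icc 1 (p - 1)

/-- `𝒫_n`, the set of primes `p` with `⌈n/2⌉ + 1 ≤ p ≤ n`. -/
def primeRange (n : ℕ) : Finset ℕ :=
  (Finset.Icc (⌈(n : ℝ) / 2⌉₊ + 1) n).filter Nat.Prime

open Classical in
/-- The probability of the event `E` when `p` is uniformly distributed on `𝒫_n` and,
given `p`, the vector `z` is uniformly distributed on `{1 : p - 1}^d`. -/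
def latticeProb (d n : ℕ) (E : ℕ → (Fin d → ℕ) → Prop) : ℝ :=
  (1 / ((primeRange n).card : ℝ)) * ∑ p ∈ primeRange n,
    (1 / ((generatingVectors d p).card : ℝ)) *
      (((generatingVectors d p).filter fun z => E p z).card : ℝ)

/-- `I_d(f)`, the integral of `f` over the unit cube. Functions on `[0,1]^d` are represented by
functions on `ℝ^d` of which only the values on the cube are ever used. -/
def cubeIntegral {d : ℕ} (f : (Fin d → ℝ) → ℂ) : ℂ :=
  ∫ x in Set.Icc (0 : Fin d → ℝ) 1, f x

/-- The rank-1 lattice rule `Q_p^z(f) = (1/p) ∑_{k=0}^{p-1} f({k z / p})`. -/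
def latticeRule {d : ℕ} (p : ℕ) (z : Fin d → ℕ) (f : (Fin d → ℝ) → ℂ) : ℂ :=
  (1 / (p : ℂ)) * ∑ k ∈ Finset.range p, f fun j => Int.fract ((k : ℝ) * (z j : ℝ) / (p : ℝ))

/-- The character `x ↦ exp(2 π i h·x)`. -/
def fourierChar {d : ℕ} (h : Fin d → ℤ) (x : Fin d → ℝ) : ℂ :=
  Complex.exp (2 * Real.pi * Complex.I * ((∑ j, (h j : ℝ) * x j : ℝ) : ℂ))

/-- The `h`-th Fourier coefficient of `f`. -/
def cubeFourierCoeff {d : ℕ} (f : (Fin d → ℝ) → ℂ) (h : Fin d → ℤ) : ℂ :=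
  cubeIntegral fun x => f x * fourierChar (-h) x

/-- `supp(h) = {j : h_j ≠ 0}`. -/
def freqSupport {d : ℕ} (h : Fin d → ℤ) : Finset (Fin d) :=
  Finset.univ.filter fun j => h j ≠ 0

/-- `r_{d,α,γ}(h) = γ_{supp h}⁻¹ ∏_{j ∈ supp h} |h_j|^α`. -/
def korobovWeight {d : ℕ} (α : ℝ) (γ : Finset (Fin d) → ℝ) (h : Fin d → ℤ) : ℝ :=
  (γ (freqSupport h))⁻¹ * ∏ j ∈ freqSupport h, |(h j : ℝ)| ^ α

/-- Membership in the weighted Korobov class: `f` is on the cube the sum of its absolutely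
convergent Fourier series, and its Korobov norm is finite. -/
structure MemKorobov {d : ℕ} (α : ℝ) (γ : Finset (Fin d) → ℝ) (f : (Fin d → ℝ) → ℂ) : Prop where
  hasSum_fourier : ∀ x ∈ Set.Icc (0 : Fin d → ℝ) 1,
    HasSum (fun h : Fin d → ℤ => cubeFourierCoeff f h * fourierChar h x) (f x)
  summable_sq : Summable fun h : Fin d → ℤ =>
    korobovWeight α γ h ^ 2 * ‖cubeFourierCoeff f h‖ ^ 2

/-- The norm `‖f‖_{d,α,γ}` of the weighted Korobov class. -/
def korobovNorm {d : ℕ} (α : ℝ) (γ : Finset (Fin d) → ℝ) (f : (Fin d → ℝ) → ℂ) : ℝ :=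
  Real.sqrt (∑' h : Fin d → ℤ, korobovWeight α γ h ^ 2 * ‖cubeFourierCoeff f h‖ ^ 2)

/-- `V_d(α,γ) = ∑_{h ≠ 0} 1 / r_{d,α,γ}(h)`, the sum of the Fourier weights. -/
def korobovV {d : ℕ} (α : ℝ) (γ : Finset (Fin d) → ℝ) : ℝ :=
  ∑' h : {h : Fin d → ℤ // h ≠ 0}, 1 / korobovWeight α γ h.1

end

/-! Write `r(h)` for the Korobov weight. By absolute convergence, `Q_p^z(f)` is the sum of the
Fourier coefficients over the dual lattice, the `h` with `p ∣ h·z`, so the error is at most the sum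
of `|f̂(h)|` over nonzero dual `h`. Two random quantities control this sum.

Let `S` be the sum of `r(h)^(-1/λ)` over nonzero dual `h`. If `p` does not divide `h`, a random `z`
makes `h` dual with probability at most `1/(p-1)`; the multiples of `p` carry at most `V/p`. Hence
`E S ≤ 4V/n`. When `S < 64V/n`, each single term is that small, so every nonzero dual `h` has `r(h)
≥ R := (n/(64V))^λ`.

Let `X` be the sum of `|f̂(h)|` over nonzero dual `h` with `r(h) ≥ R`. Here the randomness of `p`
matters: there are at least `c n / log n` primes to choose from, but at most `2 log|h_j| / log n` of
them divide `h_j ≠ 0`, so `h` is dual with probability `O((1 + log|h_j|)/n)`. The logarithm is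
absorbed into `r(h)^(δ/λ)`, and Cauchy-Schwarz over the tail `r(h) ≥ R` gives `E X ≤ B₀`, including
the additional `n^(-1/2)`.

By Markov, `S ≥ 64V/n` and `X ≥ 16 B₀` each have probability at most `1/16`. -/

/-! ### Chebyshev bounds for the primes in the upper half of `[1, n]` -/

/-- The central binomial coefficient bounded through the number of primes in `(m, 2m]`. -/
theorem centralBinom_le_primes_card (m : ℕ) (hm : 2 < m) :
    Nat.centralBinom m ≤ (2 * m) ^ Nat.sqrt (2 * m) * 4 ^ (2 * m / 3) *
      (2 * m) ^ ((Finset.Icc (m + 1) (2 * m)).filter Nat.Prime).card := by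
  have n2_pos : 1 ≤ 2 * m := by lia
  let f : ℕ → ℕ := fun x => x ^ m.centralBinom.factorization x
  let A := (Finset.range (2 * m + 1)).filter Nat.Prime
  have hA : ∏ x ∈ A, f x = Nat.centralBinom m := by
    rw [← m.prod_pow_factorization_centralBinom]
    refine Finset.prod_filter_of_ne fun p _ h => ?_
    contrapose h; dsimp only [f]
    rw [Nat.factorization_eq_zero_of_not_prime m.centralBinom h, pow_zero]
  have hle : ∀ p, f p ≤ 2 * m := fun p => Nat.pow_factorization_choose_le (by lia)
  -- As in Erdős' proof of Bertrand's postulate: each prime power in the binomial is at most `2m`,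
  -- primes above `√(2m)` occur at most once, and those in `(2m/3, m]` not at all. Only the primes
  -- above `m` are left to be counted.
  rw [← hA, ← Finset.prod_filter_mul_prod_filter_not A (· ≤ m)]
  apply mul_le_mul'
  · rw [← Finset.prod_filter_mul_prod_filter_not (A.filter (· ≤ m)) (· ≤ Nat.sqrt (2 * m))]
    apply mul_le_mul'
    · refine (Finset.prod_le_prod' fun p _ => hle p).trans ?_
      have : (Finset.Icc 1 (Nat.sqrt (2 * m))).card = Nat.sqrt (2 * m) := by simp
      rw [Finset.prod_const]
      refine pow_right_mono₀ n2_pos ((Finset.card_le_card fun x hx => ?_).trans this.le)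
      simp only [A, Finset.mem_filter] at hx
      exact Finset.mem_Icc.mpr ⟨hx.1.1.2.one_lt.le, hx.2⟩
    · refine le_trans ?_ (primorial_le_four_pow (2 * m / 3))
      rw [primorial]
      have hstep : ∀ p ∈ (A.filter (· ≤ m)).filter (¬ · ≤ Nat.sqrt (2 * m)),
          f p ≤ if p ≤ 2 * m / 3 then p else 1 := by
        intro p hp
        simp only [A, Finset.mem_filter, Finset.mem_range, not_le] at hp
        split_ifs with h
        · refine (pow_right_mono₀ hp.1.1.2.one_lt.le ?_).trans (pow_one p).le
          exact Nat.factorization_choose_le_one (Nat.sqrt_lt'.mp hp.2)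
        · have : m.centralBinom.factorization p = 0 :=
            Nat.factorization_centralBinom_of_two_mul_self_lt_three_mul hm hp.1.2 (by lia)
          simp [f, this]
      refine (Finset.prod_le_prod' hstep).trans ?_
      rw [← Finset.prod_filter]
      refine Finset.prod_le_prod_of_subset_of_one_le' ?_ ?_
      · intro p hp
        simp only [A, Finset.mem_filter, Finset.mem_range] at hp ⊢
        exact ⟨by lia, hp.1.1.1.2⟩
      · intro p hp _
        exact (Finset.mem_filter.1 hp).2.one_lt.le
  · refine (Finset.prod_le_prod' fun p _ => hle p).trans ?_
    rw [Finset.prod_const]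
    refine pow_right_mono₀ n2_pos (Finset.card_le_card fun x hx => ?_)
    simp only [A, Finset.mem_filter, Finset.mem_range, Finset.mem_Icc] at hx ⊢
    exact ⟨⟨by lia, by lia⟩, hx.1.2⟩

theorem mul_log_four_le_primes_card (m : ℕ) (hm : 4 ≤ m) :
    (m : ℝ) / 3 * Real.log 4 ≤ (√(2 * m) + 1 +
      ((Finset.Icc (m + 1) (2 * m)).filter Nat.Prime).card) * Real.log (2 * m) := by
  set k := ((Finset.Icc (m + 1) (2 * m)).filter Nat.Prime).card with hk
  have h1 := Nat.four_pow_lt_mul_centralBinom m hm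
  have h2 := centralBinom_le_primes_card m (by lia)
  have h3 : 4 ^ m ≤ (2 * m) ^ (Nat.sqrt (2 * m) + 1 + k) * 4 ^ (2 * m / 3) := by
    calc 4 ^ m ≤ m * m.centralBinom := h1.le
      _ ≤ (2 * m) * ((2 * m) ^ Nat.sqrt (2 * m) * 4 ^ (2 * m / 3) * (2 * m) ^ k) :=
        Nat.mul_le_mul (by lia) h2
      _ = _ := by ring
  have hm0 : (0 : ℝ) < m := by exact_mod_cast (by lia : 0 < m)
  have h4 : (m : ℝ) * Real.log 4 ≤ (Nat.sqrt (2 * m) + 1 + k : ℝ) * Real.log (2 * m)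
      + ((2 * m / 3 : ℕ) : ℝ) * Real.log 4 := by
    have h5 : ((4 : ℝ)) ^ m ≤ (2 * m : ℝ) ^ (Nat.sqrt (2 * m) + 1 + k) * 4 ^ (2 * m / 3) := by
      exact_mod_cast h3
    have := Real.log_le_log (by positivity) h5
    rw [Real.log_mul (by positivity) (by positivity), Real.log_pow, Real.log_pow, Real.log_pow]
      at this
    push_cast at this ⊢
    exact this
  have h6 : ((2 * m / 3 : ℕ) : ℝ) ≤ 2 * m / 3 := by
    have := @Nat.cast_div_le ℝ _ _ _ (2 * m) 3
    push_cast at this; exact this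
  have h7 : (Nat.sqrt (2 * m) : ℝ) ≤ √(2 * m) := by
    have := Real.nat_sqrt_le_real_sqrt (a := 2 * m)
    push_cast at this; exact this
  have h8 : 0 < Real.log 4 := Real.log_pos (by norm_num)
  have h9 : 0 ≤ Real.log (2 * m) := Real.log_nonneg (by
    have : (1 : ℝ) ≤ m := by exact_mod_cast (by lia : 1 ≤ m)
    linarith)
  have h10 := mul_le_mul_of_nonneg_right h6 h8.le
  have h11 : (Nat.sqrt (2 * m) + 1 + k : ℝ) * Real.log (2 * m) ≤
      (√(2 * m) + 1 + k) * Real.log (2 * m) := by gcongr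
  linarith

/-- For odd `n` the right-hand interval also contains `n + 1`, but this is even and larger than 2.
The dyadic form is the one to which Bertrand's postulate and the binomial bound apply. -/
theorem primeRange_eq (n : ℕ) (hn : 2 ≤ n) :
    primeRange n = (Finset.Icc ((n + 1) / 2 + 1) (2 * ((n + 1) / 2))).filter Nat.Prime := by
  have hc : ⌈(n : ℝ) / 2⌉₊ = (n + 1) / 2 := by
    rw [Nat.ceil_eq_iff (by lia)]
    rcases Nat.even_or_odd' n with ⟨k, rfl | rfl⟩
    · have : (2 * k + 1) / 2 = k := by lia
      rw [this]
      have hk : 1 ≤ k := by lia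
      push_cast [Nat.cast_sub hk]
      constructor <;> linarith
    · have : (2 * k + 1 + 1) / 2 = k + 1 := by lia
      rw [this]
      push_cast
      constructor
      · linarith
      · linarith
  rw [primeRange, hc]
  ext p
  simp only [Finset.mem_filter, Finset.mem_Icc]
  constructor
  · rintro ⟨⟨h1, h2⟩, h3⟩
    exact ⟨⟨h1, by lia⟩, h3⟩
  · rintro ⟨⟨h1, h2⟩, h3⟩
    refine ⟨⟨h1, ?_⟩, h3⟩
    by_contra h
    have h4 : p = 2 * ((n + 1) / 2) := by lia
    have h5 : (n + 1) / 2 = 1 := by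
      rcases (Nat.prime_mul_iff.1 (h4 ▸ h3)) with h | h
      · exact h.2
      · lia
    lia

theorem primeRange_nonempty (n : ℕ) (hn : 2 ≤ n) : (primeRange n).Nonempty := by
  obtain ⟨p, hp, h1, h2⟩ := Nat.exists_prime_lt_and_le_two_mul ((n + 1) / 2) (by lia)
  refine ⟨p, ?_⟩
  rw [primeRange_eq n hn]
  simp only [Finset.mem_filter, Finset.mem_Icc]
  exact ⟨⟨h1, h2⟩, hp⟩

/-- A Chebyshev type lower bound for the number of primes in the upper half of `[1, n]`. -/
theorem exists_mul_le_primeRange_card_mul_log :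
    ∃ c : ℝ, 0 < c ∧ ∀ n : ℕ, 2 ≤ n → c * n ≤ (primeRange n).card * Real.log n := by
  have ho : (fun x : ℝ => (√x + 1) * Real.log x) =o[Filter.atTop] (fun x : ℝ => x) := by
    have h1 : (fun x : ℝ => Real.log x) =o[Filter.atTop] (fun x : ℝ => x ^ (1 / 2 : ℝ)) :=
      isLittleO_log_rpow_atTop (by norm_num)
    have h2 : (fun x : ℝ => √x + 1) =O[Filter.atTop] (fun x : ℝ => x ^ (1 / 2 : ℝ)) := by
      refine Asymptotics.IsBigO.of_bound 2 ?_
      filter_upwards [Filter.eventually_ge_atTop 1] with x hx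
      have : 1 ≤ √x := Real.one_le_sqrt.2 hx
      rw [← Real.sqrt_eq_rpow, Real.norm_of_nonneg (by positivity),
        Real.norm_of_nonneg (by positivity)]
      linarith
    refine (h2.mul_isLittleO h1).congr' Filter.EventuallyEq.rfl ?_
    filter_upwards [Filter.eventually_ge_atTop 0] with x hx
    rw [← Real.sqrt_eq_rpow, Real.mul_self_sqrt hx]
  have hl4 : 0 < Real.log 4 := Real.log_pos (by norm_num)
  obtain ⟨N, hN⟩ := Filter.eventually_atTop.1 (ho.bound (c := Real.log 4 / 12) (by positivity))
  obtain ⟨M, hM⟩ := exists_nat_ge (max N 8)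
  have hM8 : (8 : ℝ) ≤ M := (le_max_right _ _).trans hM
  have hMN : N ≤ M := (le_max_left _ _).trans hM
  have hl2 : 0 < Real.log 2 := Real.log_pos (by norm_num)
  -- The second entry handles the finitely many `n ≤ M`, where one prime suffices; the first is the
  -- asymptotic constant.
  refine ⟨min (Real.log 4 / 24) (Real.log 2 / M), by positivity, fun n hn => ?_⟩
  have hn2 : (2 : ℝ) ≤ n := by exact_mod_cast hn
  have hln : Real.log 2 ≤ Real.log n := Real.log_le_log (by norm_num) hn2
  by_cases hnM : n ≤ M
  · have h1 : (1 : ℝ) ≤ (primeRange n).card := by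
      exact_mod_cast (primeRange_nonempty n hn).card_pos
    have hnM' : (n : ℝ) ≤ M := by exact_mod_cast hnM
    calc min (Real.log 4 / 24) (Real.log 2 / M) * n ≤ Real.log 2 / M * M := by
          gcongr
          exact min_le_right _ _
      _ = Real.log 2 := by field_simp
      _ ≤ 1 * Real.log n := by linarith
      _ ≤ _ := by gcongr
  · push Not at hnM
    have hMn : (M : ℝ) < n := by exact_mod_cast hnM
    rw [primeRange_eq n hn]
    set m := (n + 1) / 2 with hm
    have hnm : n ≤ 2 * m := by lia
    have hmn : 2 * m ≤ n + 1 := by lia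
    have hnm' : (n : ℝ) ≤ 2 * m := by exact_mod_cast hnm
    have hmn' : (2 : ℝ) * m ≤ n + 1 := by exact_mod_cast hmn
    have hM8' : 8 ≤ M := by exact_mod_cast hM8
    have h1 := mul_log_four_le_primes_card m (by lia)
    set k := ((Finset.Icc (m + 1) (2 * m)).filter Nat.Prime).card with hk
    have h2 := hN (2 * m) (by linarith)
    have hlog : 0 ≤ Real.log (2 * m) := Real.log_nonneg (by linarith)
    rw [Real.norm_of_nonneg (by positivity), Real.norm_of_nonneg (by positivity)] at h2
    have h3 : Real.log (2 * m) ≤ 2 * Real.log n := by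
      rw [← Real.log_rpow (by linarith)]
      apply Real.log_le_log (by linarith)
      norm_num
      nlinarith
    have h4 : (k : ℝ) * Real.log (2 * m) ≤ k * (2 * Real.log n) := by gcongr
    have h5 : min (Real.log 4 / 24) (Real.log 2 / M) * n ≤ Real.log 4 / 24 * (2 * m) := by
      gcongr
      exact min_le_left _ _
    -- By `h2`, the term with `√(2m) + 1` uses up at most half of `m/3 * log 4`; with `h4`, the
    -- other half gives `k * log n ≥ log 4 / 24 * (2m)`.
    nlinarith

theorem mem_primeRange {n p : ℕ} (hn : 2 ≤ n) (hp : p ∈ primeRange n) :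
    p.Prime ∧ n + 2 ≤ 2 * p ∧ p ≤ n := by
  have h := hp
  rw [primeRange_eq n hn] at hp
  simp only [primeRange, Finset.mem_filter, Finset.mem_Icc] at hp h
  exact ⟨hp.2, by lia, h.1.2⟩

/-- Few primes of `primeRange n` divide a given nonzero integer. -/
theorem card_primeRange_dvd_mul_log_le {n : ℕ} (hn : 2 ≤ n) {a : ℤ} (ha : a ≠ 0) :
    (((primeRange n).filter fun p : ℕ => (p : ℤ) ∣ a).card : ℝ) * Real.log n ≤
      2 * Real.log |(a : ℝ)| := by
  set s := (primeRange n).filter fun p : ℕ => (p : ℤ) ∣ a with hs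
  -- Distinct primes dividing `a` have their product dividing `a`, and each of them is at least
  -- `√n`.
  have hdvd : ∏ p ∈ s, p ∣ a.natAbs := by
    refine Finset.prod_primes_dvd _ (fun p hp => ?_) (fun p hp => ?_)
    · exact (mem_primeRange hn (Finset.mem_filter.1 hp).1).1.prime
    · exact Int.natCast_dvd.1 (Finset.mem_filter.1 hp).2
  have hle : ∏ p ∈ s, p ≤ a.natAbs := Nat.le_of_dvd (Int.natAbs_pos.2 ha) hdvd
  have hle' : ∏ p ∈ s, (p : ℝ) ≤ |(a : ℝ)| := by
    have : ((∏ p ∈ s, p : ℕ) : ℝ) ≤ (a.natAbs : ℝ) := by exact_mod_cast hle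
    rw [Nat.cast_natAbs] at this
    push_cast at this
    exact this
  have hpos : ∀ p ∈ s, (0 : ℝ) < p := fun p hp => by
    exact_mod_cast (mem_primeRange hn (Finset.mem_filter.1 hp).1).1.pos
  have hlog := Real.log_le_log (Finset.prod_pos hpos) hle'
  rw [Real.log_prod (fun p hp => (hpos p hp).ne')] at hlog
  have hn0 : (0 : ℝ) < n := by exact_mod_cast (by lia : 0 < n)
  have hstep : s.card • (Real.log n / 2) ≤ ∑ p ∈ s, Real.log p := by
    refine Finset.card_nsmul_le_sum _ _ _ fun p hp => ?_
    have h1 := mem_primeRange hn (Finset.mem_filter.1 hp).1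
    have h2 : (n : ℝ) ≤ (p : ℝ) ^ 2 := by
      exact_mod_cast (by nlinarith [h1.2.1] : n ≤ p ^ 2)
    have h3 := Real.log_le_log hn0 h2
    rw [Real.log_pow] at h3
    push_cast at h3
    linarith
  rw [nsmul_eq_mul] at hstep
  linarith

/-! ### The dual lattice and averages over `p` and `z` -/

open Classical in
/-- The indicator of `h` lying in the dual lattice of the rank-1 lattice given by `p` and `z`. -/
def dualIndicator {d : ℕ} (p : ℕ) (z : Fin d → ℕ) (h : Fin d → ℤ) : ℝ :=
  if (p : ℤ) ∣ ∑ j, h j * (z j : ℤ) then 1 else 0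

theorem dualIndicator_nonneg {d : ℕ} (p : ℕ) (z : Fin d → ℕ) (h : Fin d → ℤ) :
    0 ≤ dualIndicator p z h := by
  unfold dualIndicator; split_ifs <;> norm_num

theorem dualIndicator_le_one {d : ℕ} (p : ℕ) (z : Fin d → ℕ) (h : Fin d → ℤ) :
    dualIndicator p z h ≤ 1 := by
  unfold dualIndicator; split_ifs <;> norm_num

/-- The average over the generating vectors modulo `p`. -/
noncomputable def vectorMean (d p : ℕ) (g : (Fin d → ℕ) → ℝ) : ℝ :=
  (1 / ((generatingVectors d p).card : ℝ)) * ∑ z ∈ generatingVectors d p, g z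

/-- The expectation with respect to the random choice of `p` and `z`. -/
noncomputable def latticeMean (d n : ℕ) (g : ℕ → (Fin d → ℕ) → ℝ) : ℝ :=
  (1 / ((primeRange n).card : ℝ)) * ∑ p ∈ primeRange n, vectorMean d p (g p)

theorem card_generatingVectors (d p : ℕ) : (generatingVectors d p).card = (p - 1) ^ d := by
  simp [generatingVectors]

theorem generatingVectors_card_pos {d p : ℕ} (hp : p.Prime) :
    0 < (generatingVectors d p).card := by
  rw [card_generatingVectors]
  exact pow_pos (by have := hp.two_le; lia) _

theorem vectorMean_mono {d p : ℕ} {g g' : (Fin d → ℕ) → ℝ}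
    (hg : ∀ z ∈ generatingVectors d p, g z ≤ g' z) : vectorMean d p g ≤ vectorMean d p g' := by
  unfold vectorMean
  gcongr with z hz
  exact hg z hz

theorem vectorMean_const {d p : ℕ} (hp : p.Prime) (c : ℝ) : vectorMean d p (fun _ => c) = c := by
  have := generatingVectors_card_pos (d := d) hp
  unfold vectorMean
  rw [Finset.sum_const, nsmul_eq_mul]
  field_simp

theorem latticeMean_le {d n : ℕ} {g : ℕ → (Fin d → ℕ) → ℝ} {q : ℕ → ℝ}
    (hq : ∀ p ∈ primeRange n, vectorMean d p (g p) ≤ q p) :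
    latticeMean d n g ≤ (1 / ((primeRange n).card : ℝ)) * ∑ p ∈ primeRange n, q p := by
  unfold latticeMean
  gcongr with p hp
  exact hq p hp

theorem latticeMean_mono {d n : ℕ} {g g' : ℕ → (Fin d → ℕ) → ℝ}
    (hg : ∀ p ∈ primeRange n, ∀ z ∈ generatingVectors d p, g p z ≤ g' p z) :
    latticeMean d n g ≤ latticeMean d n g' :=
  latticeMean_le fun p hp => vectorMean_mono (hg p hp)

theorem latticeMean_le_const {d n : ℕ} (hn : 2 ≤ n) {g : ℕ → (Fin d → ℕ) → ℝ} {c : ℝ}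
    (hc : ∀ p ∈ primeRange n, vectorMean d p (g p) ≤ c) : latticeMean d n g ≤ c := by
  refine (latticeMean_le hc).trans ?_
  have := (primeRange_nonempty n hn).card_pos
  rw [Finset.sum_const, nsmul_eq_mul]
  apply le_of_eq
  field_simp

theorem latticeMean_add (d n : ℕ) (g g' : ℕ → (Fin d → ℕ) → ℝ) :
    latticeMean d n (fun p z => g p z + g' p z) = latticeMean d n g + latticeMean d n g' := by
  simp only [latticeMean, vectorMean, Finset.sum_add_distrib, mul_add]

theorem vectorMean_const_mul (d p : ℕ) (c : ℝ) (g : (Fin d → ℕ) → ℝ) :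
    vectorMean d p (fun z => c * g z) = c * vectorMean d p g := by
  simp only [vectorMean, ← Finset.mul_sum]
  ring

theorem latticeMean_const_mul (d n : ℕ) (c : ℝ) (g : ℕ → (Fin d → ℕ) → ℝ) :
    latticeMean d n (fun p z => c * g p z) = c * latticeMean d n g := by
  simp only [latticeMean, vectorMean_const_mul, ← Finset.mul_sum]
  ring

theorem vectorMean_hasSum {ι : Type*} {d p : ℕ} {g : ι → (Fin d → ℕ) → ℝ}
    (hg : ∀ z ∈ generatingVectors d p, Summable fun i => g i z) :
    HasSum (fun i => vectorMean d p (g i)) (vectorMean d p fun z => ∑' i, g i z) :=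
  (hasSum_sum fun z hz => (hg z hz).hasSum).mul_left _

theorem latticeMean_hasSum {ι : Type*} {d n : ℕ} {g : ι → ℕ → (Fin d → ℕ) → ℝ}
    (hg : ∀ p ∈ primeRange n, ∀ z ∈ generatingVectors d p, Summable fun i => g i p z) :
    HasSum (fun i => latticeMean d n (g i)) (latticeMean d n fun p z => ∑' i, g i p z) :=
  (hasSum_sum fun p hp => vectorMean_hasSum (hg p hp)).mul_left _

-- Expressing the failure probability as a mean reduces Markov's inequality to a pointwise bound on
-- an indicator.
open Classical in
theorem one_sub_latticeProb_eq (d n : ℕ) (hn : 2 ≤ n) (E : ℕ → (Fin d → ℕ) → Prop) :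
    1 - latticeProb d n E = latticeMean d n fun p z => if E p z then 0 else 1 := by
  have h1 : latticeProb d n E = latticeMean d n fun p z => if E p z then 1 else 0 := by
    simp only [latticeProb, latticeMean, vectorMean, Finset.sum_boole]
  have h2 : latticeMean d n (fun _ _ => (1 : ℝ)) = 1 := by
    have := (primeRange_nonempty n hn).card_pos
    unfold latticeMean
    rw [Finset.sum_congr rfl fun p hp => vectorMean_const (mem_primeRange hn hp).1 1,
      Finset.sum_const, nsmul_eq_mul]
    field_simp
  rw [h1, sub_eq_iff_eq_add, ← latticeMean_add]
  refine h2.symm.trans ?_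
  congr 1
  ext p z
  split_ifs <;> norm_num

theorem latticeProb_eq_one (d n : ℕ) (hn : 2 ≤ n) (E : ℕ → (Fin d → ℕ) → Prop)
    (hE : ∀ p ∈ primeRange n, ∀ z ∈ generatingVectors d p, E p z) : latticeProb d n E = 1 := by
  classical
  have h1 := one_sub_latticeProb_eq d n hn E
  have h2 : latticeMean d n (fun p z => if E p z then (0 : ℝ) else 1) = 0 := by
    simp only [latticeMean, vectorMean]
    rw [Finset.sum_eq_zero, mul_zero]
    intro p hp
    rw [Finset.sum_eq_zero, mul_zero]
    intro z hz
    simp [hE p hp z hz]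
  linarith

/-! ### Probability that a frequency is dual -/

/-- For `h` not divisible by `p`, at most the fraction `1 / (p - 1)` of all generating vectors has
`h` in its dual lattice. -/
theorem vectorMean_dualIndicator_le {d p : ℕ} (hp : p.Prime) {h : Fin d → ℤ} {j : Fin d}
    (hj : ¬ (p : ℤ) ∣ h j) :
    vectorMean d p (fun z => dualIndicator p z h) ≤ 1 / ((p : ℝ) - 1) := by
  classical
  have hp1 : (0 : ℝ) < (p : ℝ) - 1 := by
    have : (2 : ℝ) ≤ p := by exact_mod_cast hp.two_le
    linarith
  set s := (generatingVectors d p).filter fun z => (p : ℤ) ∣ ∑ i, h i * (z i : ℤ) with hs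
  have hcard : (p - 1) * s.card ≤ (generatingVectors d p).card := by
    have : ((Finset.Icc 1 (p - 1)) ×ˢ s).card ≤ (generatingVectors d p).card := by
      -- The entry `z j` of a dual vector is determined by the others, since `h j` is invertible
      -- modulo `p`. Overwriting it with any of the `p - 1` admissible values therefore loses no
      -- information.
      refine Finset.card_le_card_of_injOn (fun x => Function.update x.2 j x.1) ?_ ?_
      · rintro ⟨a, z⟩ hx
        simp only [Finset.coe_product, Set.mem_prod, Finset.mem_coe, hs, Finset.mem_filter,
          generatingVectors, Fintype.mem_piFinset] at hx ⊢
        intro i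
        by_cases hi : i = j
        · subst hi; simpa using hx.1
        · simpa [hi] using hx.2.1 i
      · rintro ⟨a, z⟩ hx ⟨b, y⟩ hy hxy
        simp only [Finset.coe_product, Set.mem_prod, Finset.mem_coe, hs, Finset.mem_filter,
          generatingVectors, Fintype.mem_piFinset] at hx hy hxy
        have hab : a = b := by simpa using congrFun hxy j
        have hzy : ∀ i, i ≠ j → z i = y i := fun i hi => by simpa [hi] using congrFun hxy i
        have hdiff : (p : ℤ) ∣ h j * ((z j : ℤ) - y j) := by
          have h1 := dvd_sub hx.2.2 hy.2.2
          rw [← Finset.sum_sub_distrib, Finset.sum_eq_single j] at h1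
          · rwa [mul_sub]
          · intro i _ hi
            rw [hzy i hi, sub_self]
          · simp
        have hzj : (p : ℤ) ∣ (z j : ℤ) - y j :=
          (Int.Prime.dvd_mul' hp hdiff).resolve_left hj
        have hzj' : z j = y j := by
          have h1 := hx.2.1 j
          have h2 := hy.2.1 j
          rw [Finset.mem_Icc] at h1 h2
          have := hp.two_le
          have h3 := Int.eq_zero_of_abs_lt_dvd hzj (by rw [abs_lt]; constructor <;> lia)
          lia
        refine Prod.ext hab (funext fun i => ?_)
        by_cases hi : i = j
        · subst hi; exact hzj'
        · exact hzy i hi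
    simpa using this
  have hG := generatingVectors_card_pos (d := d) hp
  have hsum : ∑ z ∈ generatingVectors d p, dualIndicator p z h = (s.card : ℝ) := by
    simp only [dualIndicator, hs, Finset.sum_boole]
  have hcard' : ((p : ℝ) - 1) * s.card ≤ (generatingVectors d p).card := by
    have h1 : (((p - 1) * s.card : ℕ) : ℝ) ≤ ((generatingVectors d p).card : ℝ) := by
      exact_mod_cast hcard
    rw [Nat.cast_mul, Nat.cast_sub hp.one_lt.le] at h1
    simpa using h1
  have hG' : (0 : ℝ) < (generatingVectors d p).card := by exact_mod_cast hG
  rw [vectorMean, hsum, one_div_mul_eq_div, div_le_div_iff₀ hG' hp1]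
  linarith

open Classical in
theorem vectorMean_dualIndicator_le_add {d p : ℕ} (hp : p.Prime) (h : Fin d → ℤ) :
    vectorMean d p (fun z => dualIndicator p z h) ≤
      (if ∀ j, (p : ℤ) ∣ h j then 1 else 0) + 1 / ((p : ℝ) - 1) := by
  have hp1 : (0 : ℝ) < (p : ℝ) - 1 := by
    have : (2 : ℝ) ≤ p := by exact_mod_cast hp.two_le
    linarith
  split_ifs with hd
  · calc vectorMean d p (fun z => dualIndicator p z h) ≤ vectorMean d p fun _ => 1 :=
        vectorMean_mono fun z _ => dualIndicator_le_one p z h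
      _ = 1 := vectorMean_const hp 1
      _ ≤ _ := by linarith [one_div_pos.2 hp1]
  · push Not at hd
    obtain ⟨j, hj⟩ := hd
    simpa using vectorMean_dualIndicator_le hp hj

/-- The `+ 1` in the lower end of `primeRange` is what makes `p - 1 ≥ n / 2`. -/
theorem one_div_prime_sub_one_le {n p : ℕ} (hn : 2 ≤ n) (hp : p ∈ primeRange n) :
    1 / ((p : ℝ) - 1) ≤ 2 / n := by
  have h1 : (n : ℝ) + 2 ≤ 2 * p := by exact_mod_cast (mem_primeRange hn hp).2.1
  have hn2 : (2 : ℝ) ≤ n := by exact_mod_cast hn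
  rw [div_le_div_iff₀ (by linarith) (by linarith)]
  linarith

/-- The probability that a frequency lies in the dual lattice of the random lattice. -/
theorem latticeMean_dualIndicator_le {d n : ℕ} (hn : 2 ≤ n) {c : ℝ} (hc : 0 < c)
    (hcn : c * n ≤ (primeRange n).card * Real.log n) {h : Fin d → ℤ} {j : Fin d} (hj : h j ≠ 0) :
    latticeMean d n (fun p z => dualIndicator p z h) ≤
      (2 / c * Real.log |(h j : ℝ)| + 2) / n := by
  classical
  have hn2 : (2 : ℝ) ≤ n := by exact_mod_cast hn
  have hlog : 0 < Real.log n := Real.log_pos (by linarith)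
  have hP : (0 : ℝ) < (primeRange n).card := by exact_mod_cast (primeRange_nonempty n hn).card_pos
  have h1 : latticeMean d n (fun p z => dualIndicator p z h) ≤
      (1 / ((primeRange n).card : ℝ)) *
        ∑ p ∈ primeRange n, ((if (p : ℤ) ∣ h j then (1 : ℝ) else 0) + 2 / n) := by
    refine latticeMean_le fun p hp => ?_
    refine (vectorMean_dualIndicator_le_add (mem_primeRange hn hp).1 h).trans ?_
    refine add_le_add ?_ (one_div_prime_sub_one_le hn hp)
    by_cases hd : ∀ j, (p : ℤ) ∣ h j
    · simp [hd]
    · rw [if_neg hd]; split_ifs <;> norm_num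
  refine h1.trans ?_
  have h2 := card_primeRange_dvd_mul_log_le hn hj
  rw [Finset.sum_add_distrib, Finset.sum_boole, Finset.sum_const, nsmul_eq_mul, mul_add]
  set k : ℝ := (((primeRange n).filter fun p : ℕ => (p : ℤ) ∣ h j).card : ℝ) with hk
  have hk0 : 0 ≤ k := by positivity
  have h3 : k * (c * n) ≤ 2 * Real.log |(h j : ℝ)| * (primeRange n).card := by
    calc k * (c * n) ≤ k * ((primeRange n).card * Real.log n) := by gcongr
      _ = k * Real.log n * (primeRange n).card := by ring
      _ ≤ _ := by gcongr
  have h4 : 1 / ((primeRange n).card : ℝ) * k ≤ 2 / c * Real.log |(h j : ℝ)| / n := by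
    rw [one_div_mul_eq_div, div_mul_eq_mul_div, div_div, div_le_div_iff₀ hP (by positivity)]
    exact h3
  have h5 : 1 / ((primeRange n).card : ℝ) * ((primeRange n).card * (2 / n)) = 2 / n := by
    field_simp
  rw [h5, add_div]
  linarith

/-! ### Estimates for the Korobov weights -/

theorem korobovWeight_pos {d : ℕ} (α : ℝ) {γ : Finset (Fin d) → ℝ} (hγ : ∀ u, 0 < γ u)
    (h : Fin d → ℤ) : 0 < korobovWeight α γ h := by
  refine mul_pos (inv_pos.2 (hγ _)) (Finset.prod_pos fun j hj => Real.rpow_pos_of_pos ?_ _)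
  simp only [freqSupport, Finset.mem_filter] at hj
  exact abs_pos.2 (by exact_mod_cast hj.2)

/-- With `s = 1/λ` this identifies `V` as the sum of `r(h)^(-1/λ)`. -/
theorem korobovWeight_rpow {d : ℕ} (α s : ℝ) {γ : Finset (Fin d) → ℝ} (hγ : ∀ u, 0 < γ u)
    (h : Fin d → ℤ) :
    korobovWeight (α * s) (fun u => γ u ^ s) h = korobovWeight α γ h ^ s := by
  unfold korobovWeight
  rw [Real.mul_rpow (inv_nonneg.2 (hγ _).le)
    (Finset.prod_nonneg fun _ _ => Real.rpow_nonneg (abs_nonneg _) _),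
    Real.inv_rpow (hγ _).le, ← Real.finsetProd_rpow _ _ fun _ _ => Real.rpow_nonneg (abs_nonneg _) _]
  congr 1
  exact Finset.prod_congr rfl fun j _ => Real.rpow_mul (abs_nonneg _) _ _

/-- Products of a summable function over finitely many coordinates are summable. -/
theorem summable_prod_apply {d : ℕ} {g : ℤ → ℝ} (hg0 : ∀ k, 0 ≤ g k) (hg : Summable g) :
    Summable fun h : Fin d → ℤ => ∏ j, g (h j) := by
  classical
  refine summable_of_sum_le (c := (∑' k, g k) ^ d)
    (fun h => Finset.prod_nonneg fun j _ => hg0 _) fun s => ?_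
  -- Any finite set of frequencies lies in the box of its coordinate projections, where the sum
  -- factorizes.
  have hsub : s ⊆ Fintype.piFinset fun j : Fin d => s.image fun h => h j := by
    intro h hh
    rw [Fintype.mem_piFinset]
    exact fun j => Finset.mem_image_of_mem _ hh
  calc ∑ h ∈ s, ∏ j, g (h j)
      ≤ ∑ h ∈ Fintype.piFinset fun j : Fin d => s.image fun h => h j, ∏ j, g (h j) :=
        Finset.sum_le_sum_of_subset_of_nonneg hsub
          fun h _ _ => Finset.prod_nonneg fun j _ => hg0 _
    _ = ∏ j : Fin d, ∑ k ∈ s.image fun h => h j, g k := (Finset.prod_univ_sum _ _).symm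
    _ ≤ ∏ _j : Fin d, ∑' k, g k :=
        Finset.prod_le_prod (fun j _ => Finset.sum_nonneg fun k _ => hg0 k)
          fun j _ => hg.sum_le_tsum _ fun k _ => hg0 k
    _ = _ := by simp

theorem summable_one_div_korobovWeight {d : ℕ} {β : ℝ} (hβ : 1 < β) {γ : Finset (Fin d) → ℝ}
    (hγ : ∀ u, 0 < γ u ∧ γ u ≤ 1) : Summable fun h : Fin d → ℤ => 1 / korobovWeight β γ h := by
  set g : ℤ → ℝ := fun k => if k ≠ 0 then |(k : ℝ)| ^ (-β) else 1 with hg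
  have hg0 : ∀ k, 0 ≤ g k := fun k => by
    simp only [hg]; split_ifs <;> positivity
  have hgs : Summable g := by
    refine Summable.of_nonneg_of_le hg0 (fun k => ?_)
      ((Real.summable_abs_int_rpow hβ).add (hasSum_ite_eq (0 : ℤ) (1 : ℝ)).summable)
    simp only [hg]
    by_cases hk : k = 0
    · subst hk
      simp only [ne_eq, not_true_eq_false, if_false, if_true]
      have : 0 ≤ |((0 : ℤ) : ℝ)| ^ (-β) := by positivity
      linarith
    · simp [hk]
  refine Summable.of_nonneg_of_le
    (fun h => (one_div_pos.2 (korobovWeight_pos β (fun u => (hγ u).1) h)).le) (fun h => ?_)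
    (summable_prod_apply hg0 hgs)
  have hprod : ∏ j, g (h j) = (∏ j ∈ freqSupport h, |(h j : ℝ)| ^ β)⁻¹ := by
    rw [freqSupport, Finset.prod_filter, ← Finset.prod_inv_distrib]
    refine Finset.prod_congr rfl fun j _ => ?_
    simp only [hg]
    split_ifs
    · exact Real.rpow_neg (abs_nonneg _) _
    · simp
  have hge : 0 ≤ ∏ j, g (h j) := Finset.prod_nonneg fun j _ => hg0 _
  rw [korobovWeight, one_div, mul_inv, inv_inv, ← hprod]
  exact mul_le_of_le_one_left hge (hγ _).2

theorem summable_subtype_one_div_korobovWeight {d : ℕ} {β : ℝ} (hβ : 1 < β)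
    {γ : Finset (Fin d) → ℝ} (hγ : ∀ u, 0 < γ u ∧ γ u ≤ 1) :
    Summable fun h : {h : Fin d → ℤ // h ≠ 0} => 1 / korobovWeight β γ h.1 :=
  (summable_one_div_korobovWeight hβ hγ).comp_injective Subtype.val_injective

/-- The indicator vector of `u` is a frequency whose term in the series is exactly `γ u`. -/
theorem le_korobovV {d : ℕ} {β : ℝ} (hβ : 1 < β) {γ : Finset (Fin d) → ℝ}
    (hγ : ∀ u, 0 < γ u ∧ γ u ≤ 1) {u : Finset (Fin d)} (hu : u.Nonempty) :
    γ u ≤ korobovV β γ := by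
  classical
  obtain ⟨j, hj⟩ := hu
  set e : Fin d → ℤ := fun i => if i ∈ u then 1 else 0 with he
  have hsupp : freqSupport e = u := by ext i; simp [freqSupport, he]
  have he0 : e ≠ 0 := fun h0 => by simpa [he, hj] using congrFun h0 j
  have hval : 1 / korobovWeight β γ e = γ u := by
    rw [korobovWeight, hsupp, Finset.prod_eq_one]
    · simp
    · intro i hi; simp [he, hi]
  rw [← hval]
  exact (summable_subtype_one_div_korobovWeight hβ hγ).le_tsum (⟨e, he0⟩ : {h : Fin d → ℤ // h ≠ 0})
    fun h _ => (one_div_pos.2 (korobovWeight_pos β (fun u => (hγ u).1) h.1)).le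

theorem freqSupport_nonempty {d : ℕ} {h : Fin d → ℤ} (hh : h ≠ 0) : (freqSupport h).Nonempty := by
  obtain ⟨j, hj⟩ := Function.ne_iff.1 hh
  exact ⟨j, by simpa [freqSupport] using hj⟩

theorem abs_rpow_le_mul_korobovWeight {d : ℕ} {α : ℝ} (hα : 0 ≤ α) {γ : Finset (Fin d) → ℝ}
    (hγ : ∀ u, 0 < γ u) {h : Fin d → ℤ} {j : Fin d} (hj : h j ≠ 0) :
    |(h j : ℝ)| ^ α ≤ γ (freqSupport h) * korobovWeight α γ h := by
  have hne := (hγ (freqSupport h)).ne'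
  rw [korobovWeight, mul_inv_cancel_left₀ hne]
  have h1 : ∀ i ∈ freqSupport h, 1 ≤ |(h i : ℝ)| ^ α := fun i hi => by
    simp only [freqSupport, Finset.mem_filter] at hi
    refine Real.one_le_rpow ?_ hα
    exact_mod_cast Int.one_le_abs hi.2
  have hjs : j ∈ freqSupport h := by simp [freqSupport, hj]
  rw [← Finset.mul_prod_erase _ _ hjs]
  refine le_mul_of_one_le_right (by positivity) ?_
  exact Finset.prod_induction _ (fun x => 1 ≤ x) (fun a b ha hb => one_le_mul_of_one_le_of_one_le ha hb)
    le_rfl fun i hi => h1 i (Finset.mem_of_mem_erase hi)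

/-- Scaling by `p` preserves the support and multiplies each of its at least one factors by `p ^ β ≥
p`. -/
theorem mul_korobovWeight_le {d : ℕ} {β : ℝ} (hβ : 1 ≤ β) {γ : Finset (Fin d) → ℝ}
    (hγ : ∀ u, 0 < γ u) {p : ℕ} (hp : 1 ≤ p) {h : Fin d → ℤ} (hh : h ≠ 0) :
    p * korobovWeight β γ h ≤ korobovWeight β γ (fun j => p * h j) := by
  have hp' : (1 : ℝ) ≤ p := by exact_mod_cast hp
  have hsupp : freqSupport (fun j => (p : ℤ) * h j) = freqSupport h := by
    ext j; simp [freqSupport]; lia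
  obtain ⟨j, hj⟩ := freqSupport_nonempty hh
  rw [korobovWeight, korobovWeight, hsupp, mul_left_comm]
  have hpβ : (p : ℝ) ≤ (p : ℝ) ^ β := Real.self_le_rpow_of_one_le hp' hβ
  refine mul_le_mul_of_nonneg_left ?_ (inv_pos.2 (hγ _)).le
  have h1 : ∏ i ∈ freqSupport h, |(((p : ℤ) * h i : ℤ) : ℝ)| ^ β =
      ((p : ℝ) ^ β) ^ (freqSupport h).card * ∏ i ∈ freqSupport h, |(h i : ℝ)| ^ β := by
    rw [← Finset.prod_const, ← Finset.prod_mul_distrib]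
    refine Finset.prod_congr rfl fun i _ => ?_
    push_cast
    rw [abs_mul, Nat.abs_cast, Real.mul_rpow (by positivity) (by positivity)]
  rw [h1]
  refine mul_le_mul_of_nonneg_right ?_ (Finset.prod_nonneg fun _ _ => by positivity)
  exact hpβ.trans (le_self_pow₀ (hp'.trans hpβ) (Finset.card_pos.2 ⟨j, hj⟩).ne')

open Classical in
/-- The contribution to `V_d` of the frequencies divisible by `p`. -/
theorem tsum_dvd_one_div_korobovWeight_le {d : ℕ} {β : ℝ} (hβ : 1 < β) {γ : Finset (Fin d) → ℝ}
    (hγ : ∀ u, 0 < γ u ∧ γ u ≤ 1) {p : ℕ} (hp : 1 ≤ p) :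
    ∑' h : {h : Fin d → ℤ // h ≠ 0},
      1 / korobovWeight β γ h.1 * (if ∀ j, (p : ℤ) ∣ h.1 j then 1 else 0) ≤
      korobovV β γ / p := by
  have hγ0 := fun u => (hγ u).1
  have hpos := fun h : Fin d → ℤ => korobovWeight_pos β hγ0 h
  have hs := summable_subtype_one_div_korobovWeight hβ hγ
  have hp0 : (0 : ℝ) < p := by exact_mod_cast hp
  have hpn : p ≠ 0 := by lia
  have hpz : (p : ℤ) ≠ 0 := by exact_mod_cast hpn
  let m : {h : Fin d → ℤ // h ≠ 0} → {h : Fin d → ℤ // h ≠ 0} := fun h =>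
    ⟨fun j => p * h.1 j, fun h0 => h.2 (funext fun j => by simpa [hpn] using congrFun h0 j)⟩
  have hm : Function.Injective m := fun a b hab => by
    refine Subtype.ext (funext fun j => ?_)
    have := congrFun (congrArg Subtype.val hab) j
    simpa [m, hpn] using this
  have hrange : Function.support (fun h : {h : Fin d → ℤ // h ≠ 0} =>
      1 / korobovWeight β γ h.1 * (if ∀ j, (p : ℤ) ∣ h.1 j then (1 : ℝ) else 0)) ⊆ Set.range m := by
    intro h hh
    have hd : ∀ j, (p : ℤ) ∣ h.1 j := by
      by_contra hd
      simp [hd] at hh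
    choose k hk using hd
    refine ⟨⟨k, fun h0 => h.2 (funext fun j => ?_)⟩, Subtype.ext (funext fun j => (hk j).symm)⟩
    simp [hk j, h0]
  rw [← hm.tsum_eq hrange, korobovV, ← tsum_div_const]
  have hle : ∀ h : {h : Fin d → ℤ // h ≠ 0}, 1 / korobovWeight β γ (m h).1 *
      (if ∀ j, (p : ℤ) ∣ (m h).1 j then (1 : ℝ) else 0) ≤ 1 / korobovWeight β γ h.1 / p := by
    intro h
    rw [if_pos fun j => dvd_mul_right _ _, mul_one, div_div, mul_comm]
    exact one_div_le_one_div_of_le (mul_pos hp0 (hpos _)) (mul_korobovWeight_le hβ.le hγ0 hp h.2)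
  refine Summable.tsum_le_tsum hle (Summable.of_nonneg_of_le (fun h => ?_) hle (hs.div_const _))
    (hs.div_const _)
  have := (one_div_pos.2 (hpos (m h).1)).le
  split_ifs <;> simp
  exact (hpos _).le

/-! ### Fourier expansion of the lattice rule -/

theorem fourierChar_zero {d : ℕ} (x : Fin d → ℝ) : fourierChar (0 : Fin d → ℤ) x = 1 := by
  simp [fourierChar]

theorem fourierChar_fract {d : ℕ} (h : Fin d → ℤ) (x : Fin d → ℝ) :
    fourierChar h (fun j => Int.fract (x j)) = fourierChar h x := by
  unfold fourierChar
  rw [Complex.exp_eq_exp_iff_exists_int]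
  refine ⟨-∑ j, h j * ⌊x j⌋, ?_⟩
  simp only [Int.fract, mul_sub, Finset.sum_sub_distrib]
  push_cast
  ring

theorem cubeFourierCoeff_zero {d : ℕ} (f : (Fin d → ℝ) → ℂ) :
    cubeFourierCoeff f 0 = cubeIntegral f := by
  simp [cubeFourierCoeff, fourierChar_zero]

/-- The average of a character over the lattice points. -/
theorem sum_fourierChar_lattice {d p : ℕ} (hp : 1 ≤ p) (z : Fin d → ℕ) (h : Fin d → ℤ) :
    (1 / (p : ℂ)) * ∑ k ∈ Finset.range p,
      fourierChar h (fun j => Int.fract ((k : ℝ) * (z j : ℝ) / (p : ℝ))) =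
      (dualIndicator p z h : ℂ) := by
  have hp0 : (p : ℂ) ≠ 0 := by exact_mod_cast (by lia : p ≠ 0)
  set N : ℤ := ∑ j, h j * (z j : ℤ) with hN
  set ω : ℂ := Complex.exp (2 * Real.pi * Complex.I * (N / p)) with hω
  have hchar : ∀ k : ℕ, fourierChar h (fun j => Int.fract ((k : ℝ) * (z j : ℝ) / (p : ℝ))) =
      ω ^ k := by
    intro k
    rw [fourierChar_fract h fun j => (k : ℝ) * (z j : ℝ) / (p : ℝ), hω, ← Complex.exp_nat_mul,
      fourierChar]
    congr 1
    rw [hN]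
    push_cast
    rw [Finset.sum_div, Finset.mul_sum, Finset.mul_sum, Finset.mul_sum]
    refine Finset.sum_congr rfl fun j _ => ?_
    ring
  simp only [hchar]
  have hωp : ω ^ p = 1 := by
    rw [hω, ← Complex.exp_nat_mul, Complex.exp_eq_one_iff]
    exact ⟨N, by field_simp⟩
  have hone : ω = 1 ↔ (p : ℤ) ∣ N := by
    rw [hω, Complex.exp_eq_one_iff]
    have hpi : (2 * Real.pi * Complex.I : ℂ) ≠ 0 := Complex.two_pi_I_ne_zero
    constructor
    · rintro ⟨m, hm⟩
      refine ⟨m, ?_⟩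
      rw [mul_comm (m : ℂ)] at hm
      have h1 := mul_left_cancel₀ hpi hm
      rw [div_eq_iff hp0] at h1
      have h2 : N = m * p := by exact_mod_cast h1
      rw [h2, mul_comm]
    · rintro ⟨m, hm⟩
      refine ⟨m, ?_⟩
      rw [hm]
      push_cast
      field_simp
  unfold dualIndicator
  split_ifs with hd
  · rw [hone.2 hd]
    simp [hp0]
  · have hne : ω ≠ 1 := fun h1 => hd (hone.1 h1)
    rw [geom_sum_eq hne, hωp]
    simp

theorem hasSum_latticeRule {d p : ℕ} (hp : 1 ≤ p) {α : ℝ} {γ : Finset (Fin d) → ℝ}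
    {f : (Fin d → ℝ) → ℂ} (hf : MemKorobov α γ f) (z : Fin d → ℕ) :
    HasSum (fun h => cubeFourierCoeff f h * (dualIndicator p z h : ℂ)) (latticeRule p z f) := by
  have h1 : ∀ k ∈ Finset.range p, HasSum (fun h => cubeFourierCoeff f h *
      fourierChar h (fun j => Int.fract ((k : ℝ) * (z j : ℝ) / (p : ℝ))))
      (f fun j => Int.fract ((k : ℝ) * (z j : ℝ) / (p : ℝ))) := fun k _ =>
    hf.hasSum_fourier _ ⟨fun j => Int.fract_nonneg _, fun j => (Int.fract_lt_one _).le⟩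
  refine ((hasSum_sum h1).mul_left (1 / (p : ℂ))).congr_fun ?_
  intro h
  rw [← sum_fourierChar_lattice hp z h, ← Finset.mul_sum]
  ring

theorem summable_norm_cubeFourierCoeff {d : ℕ} {α : ℝ} {γ : Finset (Fin d) → ℝ}
    {f : (Fin d → ℝ) → ℂ} (hf : MemKorobov α γ f) :
    Summable fun h : Fin d → ℤ => ‖cubeFourierCoeff f h‖ := by
  have h1 := (hf.hasSum_fourier 0 (by simp [Set.mem_Icc])).summable
  have h2 : ∀ h : Fin d → ℤ, fourierChar h 0 = 1 := fun h => by simp [fourierChar]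
  simp only [h2, mul_one] at h1
  exact h1.norm

theorem summable_norm_mul_dualIndicator {d : ℕ} {α : ℝ} {γ : Finset (Fin d) → ℝ}
    {f : (Fin d → ℝ) → ℂ} (hf : MemKorobov α γ f) (p : ℕ) (z : Fin d → ℕ) :
    Summable fun h : {h : Fin d → ℤ // h ≠ 0} =>
      ‖cubeFourierCoeff f h.1‖ * dualIndicator p z h.1 :=
  Summable.of_nonneg_of_le
    (fun h => mul_nonneg (norm_nonneg _) (dualIndicator_nonneg p z h.1))
    (fun h => mul_le_of_le_one_right (norm_nonneg _) (dualIndicator_le_one p z h.1))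
    ((summable_norm_cubeFourierCoeff hf).comp_injective Subtype.val_injective)

/-- The integration error is bounded by the Fourier coefficients on the dual lattice. -/
theorem norm_cubeIntegral_sub_latticeRule_le {d p : ℕ} (hp : 1 ≤ p) {α : ℝ}
    {γ : Finset (Fin d) → ℝ} {f : (Fin d → ℝ) → ℂ} (hf : MemKorobov α γ f) (z : Fin d → ℕ) :
    ‖cubeIntegral f - latticeRule p z f‖ ≤
      ∑' h : {h : Fin d → ℤ // h ≠ 0}, ‖cubeFourierCoeff f h.1‖ * dualIndicator p z h.1 := by
  classical
  -- The zero frequency is always dual and contributes exactly the integral.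
  have h1 := (hasSum_latticeRule hp hf z).sub (hasSum_ite_eq (0 : Fin d → ℤ) (cubeIntegral f))
  have h0 : dualIndicator p z (0 : Fin d → ℤ) = 1 := by simp [dualIndicator]
  set F : (Fin d → ℤ) → ℂ := fun h => cubeFourierCoeff f h * (dualIndicator p z h : ℂ) -
    (if h = 0 then cubeIntegral f else 0) with hF
  have hsupp : Function.support F ⊆ {h | h ≠ 0} := by
    intro h hh h00
    apply hh
    simp [hF, h00, h0, cubeFourierCoeff_zero]
  have h2 := (hasSum_subtype_iff_of_support_subset hsupp).2 h1
  have hnorm : ∀ h : {h : Fin d → ℤ // h ≠ 0},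
      ‖F h.1‖ = ‖cubeFourierCoeff f h.1‖ * dualIndicator p z h.1 := by
    intro h
    simp only [hF, if_neg h.2, sub_zero, norm_mul, Complex.norm_real,
      Real.norm_of_nonneg (dualIndicator_nonneg p z h.1)]
  have hs := summable_norm_mul_dualIndicator hf p z
  rw [norm_sub_rev]
  refine tsum_of_norm_bounded hs.hasSum (f := fun h : {h : Fin d → ℤ // h ≠ 0} => F h.1)
    (fun h => (hnorm h).le) |> fun h3 => ?_
  rw [← h2.tsum_eq]
  exact h3

/-! ### The two expectations -/

/-- The mean of the sum of the inverse weights over the dual lattice. -/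
theorem latticeMean_tsum_one_div_korobovWeight_le {d n : ℕ} (hn : 2 ≤ n) {β : ℝ} (hβ : 1 < β)
    {γ : Finset (Fin d) → ℝ} (hγ : ∀ u, 0 < γ u ∧ γ u ≤ 1) :
    latticeMean d n (fun p z => ∑' h : {h : Fin d → ℤ // h ≠ 0},
      1 / korobovWeight β γ h.1 * dualIndicator p z h.1) ≤ 4 * korobovV β γ / n := by
  classical
  have hs := summable_subtype_one_div_korobovWeight hβ hγ
  have hpos := fun h : Fin d → ℤ => (one_div_pos.2 (korobovWeight_pos β (fun u => (hγ u).1) h)).le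
  have hV : 0 ≤ korobovV β γ := tsum_nonneg fun h => hpos h.1
  refine latticeMean_le_const hn fun p hp => ?_
  obtain ⟨hpp, hp1, -⟩ := mem_primeRange hn hp
  have hsd : ∀ z ∈ generatingVectors d p, Summable fun h : {h : Fin d → ℤ // h ≠ 0} =>
      1 / korobovWeight β γ h.1 * dualIndicator p z h.1 := fun z _ =>
    Summable.of_nonneg_of_le (fun h => mul_nonneg (hpos h.1) (dualIndicator_nonneg p z h.1))
      (fun h => mul_le_of_le_one_right (hpos h.1) (dualIndicator_le_one p z h.1)) hs
  have h1 := vectorMean_hasSum hsd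
  have hsi : Summable fun h : {h : Fin d → ℤ // h ≠ 0} =>
      1 / korobovWeight β γ h.1 * (if ∀ j, (p : ℤ) ∣ h.1 j then (1 : ℝ) else 0) :=
    Summable.of_nonneg_of_le (fun h => mul_nonneg (hpos h.1) (by split_ifs <;> norm_num))
      (fun h => mul_le_of_le_one_right (hpos h.1) (by split_ifs <;> norm_num)) hs
  have h2 := hsi.hasSum.add (hs.hasSum.mul_right (1 / ((p : ℝ) - 1)))
  have h3 := hasSum_le (fun h : {h : Fin d → ℤ // h ≠ 0} => by
    rw [vectorMean_const_mul, ← mul_add]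
    exact mul_le_mul_of_nonneg_left (vectorMean_dualIndicator_le_add hpp h.1) (hpos h.1)) h1 h2
  refine h3.trans ?_
  have h4 := tsum_dvd_one_div_korobovWeight_le hβ hγ hpp.one_lt.le
  have hn0 : (0 : ℝ) < n := by exact_mod_cast (by lia : 0 < n)
  have h5 : korobovV β γ / p ≤ korobovV β γ * (2 / n) := by
    have : (n : ℝ) ≤ 2 * p := by exact_mod_cast (by lia : n ≤ 2 * p)
    rw [div_eq_mul_inv, ← one_div]
    refine mul_le_mul_of_nonneg_left ?_ hV
    rw [div_le_div_iff₀ (by exact_mod_cast hpp.pos) hn0]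
    linarith
  have h6 : korobovV β γ * (1 / ((p : ℝ) - 1)) ≤ korobovV β γ * (2 / n) :=
    mul_le_mul_of_nonneg_left (one_div_prime_sub_one_le hn hp) hV
  have h7 : 4 * korobovV β γ / n = korobovV β γ * (2 / n) + korobovV β γ * (2 / n) := by ring
  rw [h7]
  exact add_le_add (h4.trans h5) h6

/-- Uses `log t ≤ t ^ ε / ε` with `ε = δ / lam`; this is where the loss `δ` in the rate arises. -/
theorem latticeMean_dualIndicator_le_rpow {d n : ℕ} (hn : 2 ≤ n) {c : ℝ} (hc : 0 < c)
    (hcn : c * n ≤ (primeRange n).card * Real.log n) {lam δ : ℝ} (hlam : 0 < lam) (hδ : 0 < δ)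
    {h : Fin d → ℤ} (hh : h ≠ 0) {y : ℝ} (hy : ∀ j, h j ≠ 0 → |(h j : ℝ)| ^ lam ≤ y) :
    latticeMean d n (fun p z => dualIndicator p z h) ≤
      (2 / (c * δ) + 2) / n * y ^ (δ / lam) := by
  obtain ⟨j, hj⟩ := Function.ne_iff.1 hh
  have hj' : h j ≠ 0 := hj
  have habs : 1 ≤ |(h j : ℝ)| := by exact_mod_cast Int.one_le_abs hj'
  have h1 : 1 ≤ |(h j : ℝ)| ^ lam := Real.one_le_rpow habs hlam.le
  have hy1 : 1 ≤ y := h1.trans (hy j hj')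
  have hlog : lam * Real.log |(h j : ℝ)| ≤ y ^ (δ / lam) / (δ / lam) := by
    rw [← Real.log_rpow (by linarith)]
    exact (Real.log_le_log (by linarith) (hy j hj')).trans
      (Real.log_le_rpow_div (by linarith) (by positivity))
  have hlog' : Real.log |(h j : ℝ)| ≤ y ^ (δ / lam) / δ := by
    have : y ^ (δ / lam) / (δ / lam) = lam * (y ^ (δ / lam) / δ) := by field_simp
    rw [this] at hlog
    exact le_of_mul_le_mul_left hlog hlam
  have hpow : 1 ≤ y ^ (δ / lam) := Real.one_le_rpow hy1 (by positivity)
  refine (latticeMean_dualIndicator_le hn hc hcn hj').trans ?_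
  rw [div_mul_eq_mul_div (2 / (c * δ) + 2)]
  have hn0 : (0 : ℝ) < n := by exact_mod_cast (by lia : 0 < n)
  refine (div_le_div_iff_of_pos_right hn0).2 ?_
  have : 2 / c * Real.log |(h j : ℝ)| ≤ 2 / c * (y ^ (δ / lam) / δ) := by gcongr
  calc 2 / c * Real.log |(h j : ℝ)| + 2 ≤ 2 / c * (y ^ (δ / lam) / δ) + 2 * y ^ (δ / lam) := by
        linarith
    _ = _ := by field_simp

open Classical in
/-- The Fourier coefficients of large weight, by the Cauchy-Schwarz inequality. -/
theorem tsum_cubeFourierCoeff_tail_le {d : ℕ} {α ε s R V : ℝ} (hR : 0 < R)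
    {γ : Finset (Fin d) → ℝ} (hγ : ∀ u, 0 < γ u) {f : (Fin d → ℝ) → ℂ} (hf : MemKorobov α γ f)
    (hε : 2 * ε + s ≤ 2)
    (hV : HasSum (fun h : {h : Fin d → ℤ // h ≠ 0} => korobovWeight α γ h.1 ^ (-s)) V) :
    (Summable fun h : {h : Fin d → ℤ // h ≠ 0} => ‖cubeFourierCoeff f h.1‖ *
      (if R ≤ korobovWeight α γ h.1 then korobovWeight α γ h.1 ^ ε else 0)) ∧
    ∑' h : {h : Fin d → ℤ // h ≠ 0}, ‖cubeFourierCoeff f h.1‖ *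
      (if R ≤ korobovWeight α γ h.1 then korobovWeight α γ h.1 ^ ε else 0) ≤
      korobovNorm α γ f * √(R ^ (2 * ε + s - 2) * V) := by
  have hW := fun h : Fin d → ℤ => korobovWeight_pos α hγ h
  -- Factor `|f̂| r^ε` as `(r |f̂|) * r^(ε-1)`. On `r ≥ R` the square of the second factor is at
  -- most `R^(2ε+s-2) r^(-s)`, because that exponent of `R` is nonpositive.
  set a : {h : Fin d → ℤ // h ≠ 0} → ℝ := fun h =>
    korobovWeight α γ h.1 * ‖cubeFourierCoeff f h.1‖ with ha
  set b : {h : Fin d → ℤ // h ≠ 0} → ℝ := fun h =>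
    if R ≤ korobovWeight α γ h.1 then korobovWeight α γ h.1 ^ (ε - 1) else 0 with hb
  have ha0 : ∀ h, 0 ≤ a h := fun h => mul_nonneg (hW h.1).le (norm_nonneg _)
  have hb0 : ∀ h, 0 ≤ b h := fun h => by
    simp only [hb]; split_ifs
    · exact Real.rpow_nonneg (hW h.1).le _
    · exact le_rfl
  have hsq := hf.summable_sq.comp_injective
    (Subtype.val_injective (p := fun h : Fin d → ℤ => h ≠ 0))
  have ha2 : (fun h => a h ^ (2 : ℝ)) = (fun h : Fin d → ℤ =>
      korobovWeight α γ h ^ 2 * ‖cubeFourierCoeff f h‖ ^ 2) ∘ Subtype.val := by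
    ext h
    simp only [ha, Function.comp, Real.rpow_two, mul_pow]
  have hbR : ∀ h, b h ^ (2 : ℝ) ≤ R ^ (2 * ε + s - 2) * korobovWeight α γ h.1 ^ (-s) := by
    intro h
    have hWs : 0 ≤ korobovWeight α γ h.1 ^ (-s) := Real.rpow_nonneg (hW h.1).le _
    simp only [hb]
    split_ifs with hRW
    · rw [← Real.rpow_mul (hW h.1).le]
      have : (ε - 1) * 2 = (2 * ε + s - 2) + -s := by ring
      rw [this, Real.rpow_add (hW h.1)]
      exact mul_le_mul_of_nonneg_right
        (Real.rpow_le_rpow_of_nonpos hR hRW (by linarith)) hWs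
    · rw [Real.zero_rpow (by norm_num)]
      exact mul_nonneg (Real.rpow_nonneg hR.le _) hWs
  have hbs : Summable fun h => b h ^ (2 : ℝ) :=
    Summable.of_nonneg_of_le (fun h => Real.rpow_nonneg (hb0 h) _) hbR (hV.mul_left _).summable
  have hbt : ∑' h, b h ^ (2 : ℝ) ≤ R ^ (2 * ε + s - 2) * V :=
    hasSum_le hbR hbs.hasSum (hV.mul_left _)
  have hCS := Real.summable_and_inner_le_Lp_mul_Lq_tsum_of_nonneg Real.HolderConjugate.two_two
    ha0 hb0 (by rw [ha2]; exact hsq) hbs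
  have hab : (fun h => a h * b h) = fun h : {h : Fin d → ℤ // h ≠ 0} =>
      ‖cubeFourierCoeff f h.1‖ *
        (if R ≤ korobovWeight α γ h.1 then korobovWeight α γ h.1 ^ ε else 0) := by
    ext h
    simp only [ha, hb]
    split_ifs
    · rw [Real.rpow_sub_one (hW h.1).ne']
      field_simp [(hW h.1).ne']
    · simp
  rw [hab] at hCS
  refine ⟨hCS.1, hCS.2.trans ?_⟩
  rw [← Real.sqrt_eq_rpow, ← Real.sqrt_eq_rpow, korobovNorm]
  have hat : ∑' h, a h ^ (2 : ℝ) ≤ ∑' h : Fin d → ℤ,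
      korobovWeight α γ h ^ 2 * ‖cubeFourierCoeff f h‖ ^ 2 := by
    rw [ha2]
    exact Summable.tsum_subtype_le _ {h : Fin d → ℤ | h ≠ 0} (fun h => by positivity) hf.summable_sq
  gcongr

theorem exponent_identity {lam δ V N K F : ℝ} (hlam : 0 < lam) (hV : 0 < V) (hN : 0 < N) :
    K / N * V ^ δ * (F * √(((N / (64 * V)) ^ lam) ^ (2 * (δ / lam) + 1 / lam - 2) * V)) =
      K * 64 ^ (lam - δ - 1 / 2) * V ^ lam * N ^ (-lam - 1 / 2 + δ) * F := by
  have h1 : ((N / (64 * V)) ^ lam) ^ (2 * (δ / lam) + 1 / lam - 2) =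
      (N / (64 * V)) ^ (2 * (δ - lam + 1 / 2)) := by
    rw [← Real.rpow_mul (by positivity)]
    congr 1
    field_simp
    ring
  have h2 : √((N / (64 * V)) ^ (2 * (δ - lam + 1 / 2)) * V) =
      (N / (64 * V)) ^ (δ - lam + 1 / 2) * V ^ (1 / 2 : ℝ) := by
    rw [Real.sqrt_mul (by positivity), Real.sqrt_eq_rpow, Real.sqrt_eq_rpow,
      ← Real.rpow_mul (by positivity)]
    congr 2
    ring
  have h3 : (N / (64 * V)) ^ (δ - lam + 1 / 2) =
      N ^ (δ - lam + 1 / 2) * (64 ^ (lam - δ - 1 / 2) * V ^ (lam - δ - 1 / 2)) := by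
    rw [Real.div_rpow hN.le (by positivity), div_eq_mul_inv, ← Real.rpow_neg (by positivity),
      Real.mul_rpow (by norm_num) hV.le]
    congr 3 <;> ring
  have h4 : V ^ lam = V ^ δ * V ^ (lam - δ - 1 / 2) * V ^ (1 / 2 : ℝ) := by
    rw [← Real.rpow_add hV, ← Real.rpow_add hV]
    congr 1; ring
  have h5 : N ^ (-lam - 1 / 2 + δ) = N ^ (δ - lam + 1 / 2) / N := by
    rw [← Real.rpow_sub_one hN.ne']
    congr 1; ring
  rw [h1, h2, h3, h4, h5]
  ring

open Classical in
/-- The mean of the sum of the Fourier coefficients of large weight over the dual lattice. -/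
theorem latticeMean_tsum_cubeFourierCoeff_le {d n : ℕ} (hn : 2 ≤ n) {c : ℝ} (hc : 0 < c)
    (hcn : c * n ≤ (primeRange n).card * Real.log n) {lam δ α V : ℝ} (hlam : 0 < lam) (hδ : 0 < δ)
    (hδ' : δ ≤ lam - 1 / 2) {γ : Finset (Fin d) → ℝ} (hγ : ∀ u, 0 < γ u)
    {f : (Fin d → ℝ) → ℂ} (hf : MemKorobov α γ f) (hV0 : 0 < V)
    (hV : HasSum (fun h : {h : Fin d → ℤ // h ≠ 0} => korobovWeight α γ h.1 ^ (-(1 / lam))) V)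
    (hVW : ∀ h : Fin d → ℤ, ∀ j, h j ≠ 0 →
      |(h j : ℝ)| ^ lam ≤ V ^ lam * korobovWeight α γ h) :
    latticeMean d n (fun p z => ∑' h : {h : Fin d → ℤ // h ≠ 0},
      (if (n / (64 * V)) ^ lam ≤ korobovWeight α γ h.1 then ‖cubeFourierCoeff f h.1‖ else 0) *
        dualIndicator p z h.1) ≤
      (2 / (c * δ) + 2) * 64 ^ (lam - δ - 1 / 2) * V ^ lam * (n : ℝ) ^ (-lam - 1 / 2 + δ) *
        korobovNorm α γ f := by
  have hn0 : (0 : ℝ) < n := by exact_mod_cast (by lia : 0 < n)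
  set R : ℝ := (n / (64 * V)) ^ lam with hR
  have hR0 : 0 < R := Real.rpow_pos_of_pos (by positivity) _
  have hε : 2 * (δ / lam) + 1 / lam ≤ 2 := by
    rw [← mul_div_assoc, ← add_div, div_le_iff₀ hlam]
    linarith
  obtain ⟨hs, ht⟩ := tsum_cubeFourierCoeff_tail_le hR0 hγ hf hε hV
  rw [← exponent_identity hlam hV0 hn0]
  have hsd : ∀ p ∈ primeRange n, ∀ z ∈ generatingVectors d p,
      Summable fun h : {h : Fin d → ℤ // h ≠ 0} =>
        (if R ≤ korobovWeight α γ h.1 then ‖cubeFourierCoeff f h.1‖ else 0) *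
          dualIndicator p z h.1 := by
    intro p _ z _
    refine Summable.of_nonneg_of_le (fun h => mul_nonneg (by split_ifs <;> simp)
      (dualIndicator_nonneg p z h.1)) (fun h => ?_) (summable_norm_mul_dualIndicator hf p z)
    refine mul_le_mul_of_nonneg_right ?_ (dualIndicator_nonneg p z h.1)
    split_ifs <;> simp
  have h1 := latticeMean_hasSum hsd
  refine (hasSum_le (fun h => ?_) h1 (hs.hasSum.mul_left ((2 / (c * δ) + 2) / n * V ^ δ))).trans ?_
  · rw [latticeMean_const_mul]
    split_ifs with hRW
    · have h2 := latticeMean_dualIndicator_le_rpow hn hc hcn hlam hδ h.2 (hVW h.1)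
      have h3 : (V ^ lam * korobovWeight α γ h.1) ^ (δ / lam) =
          V ^ δ * korobovWeight α γ h.1 ^ (δ / lam) := by
        rw [Real.mul_rpow (by positivity) (korobovWeight_pos α hγ h.1).le,
          ← Real.rpow_mul hV0.le]
        congr 2
        field_simp
      rw [h3] at h2
      refine (mul_le_mul_of_nonneg_left h2 (norm_nonneg _)).trans_eq ?_
      ring
    · simp
  · exact mul_le_mul_of_nonneg_left ht (by positivity)

/-! ### Markov's inequality and conclusion -/

/-- If every dual frequency has large weight, only these frequencies contribute to the error. -/
theorem one_le_add_of_error_gt {d n p : ℕ} (hp : 1 ≤ p) (hn : 2 ≤ n) {lam α V B : ℝ}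
    (hlam : 0 < lam) {γ : Finset (Fin d) → ℝ} (hγ : ∀ u, 0 < γ u)
    {f : (Fin d → ℝ) → ℂ} (hf : MemKorobov α γ f) (hV0 : 0 < V)
    (hV : HasSum (fun h : {h : Fin d → ℤ // h ≠ 0} => korobovWeight α γ h.1 ^ (-(1 / lam))) V)
    {z : Fin d → ℕ} (hB : 0 < B) (herr : B < ‖cubeIntegral f - latticeRule p z f‖)
    {S X : ℝ} (hS : S = ∑' h : {h : Fin d → ℤ // h ≠ 0},
      korobovWeight α γ h.1 ^ (-(1 / lam)) * dualIndicator p z h.1) (hX0 : 0 ≤ X)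
    [∀ x : ℝ, Decidable ((n / (64 * V)) ^ lam ≤ x)]
    (hX : X = ∑' h : {h : Fin d → ℤ // h ≠ 0},
      (if (n / (64 * V)) ^ lam ≤ korobovWeight α γ h.1 then ‖cubeFourierCoeff f h.1‖ else 0) *
        dualIndicator p z h.1) :
    1 ≤ n / (64 * V) * S + 1 / B * X := by
  have hn0 : (0 : ℝ) < n := by exact_mod_cast (by lia : 0 < n)
  have hW := fun h : Fin d → ℤ => korobovWeight_pos α hγ h
  have hterm : ∀ h : {h : Fin d → ℤ // h ≠ 0},
      0 ≤ korobovWeight α γ h.1 ^ (-(1 / lam)) * dualIndicator p z h.1 := fun h =>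
    mul_nonneg (Real.rpow_nonneg (hW h.1).le _) (dualIndicator_nonneg p z h.1)
  have hS0 : 0 ≤ S := hS ▸ tsum_nonneg hterm
  have hQ : 0 < n / (64 * V) := by positivity
  by_cases hST : 1 ≤ n / (64 * V) * S
  · have : 0 ≤ 1 / B * X := by positivity
    linarith
  · push Not at hST
    have hsum : Summable fun h : {h : Fin d → ℤ // h ≠ 0} =>
        korobovWeight α γ h.1 ^ (-(1 / lam)) * dualIndicator p z h.1 :=
      Summable.of_nonneg_of_le hterm (fun h => mul_le_of_le_one_right
        (Real.rpow_nonneg (hW h.1).le _) (dualIndicator_le_one p z h.1)) hV.summable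
    have hXerr : ‖cubeIntegral f - latticeRule p z f‖ ≤ X := by
      refine (norm_cubeIntegral_sub_latticeRule_le hp hf z).trans_eq ?_
      rw [hX]
      refine tsum_congr fun h => ?_
      by_cases hd : dualIndicator p z h.1 = 0
      · simp [hd]
      · have hd1 : dualIndicator p z h.1 = 1 := by
          unfold dualIndicator at hd ⊢
          split_ifs at hd ⊢ <;> simp_all
        rw [if_pos]
        have h1 : korobovWeight α γ h.1 ^ (-(1 / lam)) ≤ S := by
          have := hsum.le_tsum h fun h' _ => hterm h'
          rwa [hd1, mul_one, ← hS] at this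
        have h2 : n / (64 * V) * korobovWeight α γ h.1 ^ (-(1 / lam)) ≤ 1 :=
          (mul_le_mul_of_nonneg_left h1 hQ.le).trans hST.le
        rw [Real.rpow_neg (hW h.1).le, ← div_eq_mul_inv,
          div_le_one (Real.rpow_pos_of_pos (hW h.1) _)] at h2
        have h3 := Real.rpow_le_rpow hQ.le h2 hlam.le
        rwa [← Real.rpow_mul (hW h.1).le, one_div_mul_cancel hlam.ne', Real.rpow_one] at h3
    have h4 : 1 ≤ 1 / B * X := by
      rw [one_div_mul_eq_div, one_le_div hB]
      exact (herr.trans_le hXerr).le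
    have : 0 ≤ n / (64 * V) * S := by positivity
    linarith

theorem corollary2 (lam δ : ℝ) (hlam : 1 / 2 < lam) (hδ : 0 < δ)
    (hδ' : δ < min (lam - 1 / 2) 1) :
    ∃ C : ℝ, 0 < C ∧
      ∀ (d : ℕ) (α : ℝ) (γ : Finset (Fin d) → ℝ) (f : (Fin d → ℝ) → ℂ) (n : ℕ),
        lam < α →
        (∀ u, 0 < γ u ∧ γ u ≤ 1) →
        MemKorobov α γ f →
        2 ≤ n →
        64 * korobovV (α / lam) (fun u => γ u ^ (1 / lam)) ≤ (n : ℝ) →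
        7 / 8 ≤ latticeProb d n fun p z =>
          ‖cubeIntegral f - latticeRule p z f‖ ≤
            16 * C * korobovV (α / lam) (fun u => γ u ^ (1 / lam)) ^ lam *
              (n : ℝ) ^ (-lam - 1 / 2 + δ) * korobovNorm α γ f := by
  classical
  obtain ⟨c, hc, hcn⟩ := exists_mul_le_primeRange_card_mul_log
  have hlam0 : 0 < lam := by linarith
  refine ⟨(2 / (c * δ) + 2) * 64 ^ (lam - δ - 1 / 2), by positivity, ?_⟩
  intro d α γ f n hα hγ hf hn _
  have hγ0 := fun u => (hγ u).1
  have hW := fun h : Fin d → ℤ => korobovWeight_pos α hγ0 h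
  have hn0 : (0 : ℝ) < n := by exact_mod_cast (by lia : 0 < n)
  -- If only the zero frequency is present, the rule is exact. Otherwise `V` and the norm are
  -- positive and may be divided by.
  by_cases hf0 : ∀ h : Fin d → ℤ, h ≠ 0 → cubeFourierCoeff f h = 0
  · have hV0 : 0 ≤ korobovV (α / lam) (fun u => γ u ^ (1 / lam)) :=
      tsum_nonneg fun h => (one_div_pos.2
        (korobovWeight_pos _ (fun u => Real.rpow_pos_of_pos (hγ0 u) _) h.1)).le
    rw [latticeProb_eq_one d n hn]
    · norm_num
    intro p hp z _
    have h1 := norm_cubeIntegral_sub_latticeRule_le (mem_primeRange hn hp).1.one_lt.le hf z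
    have h2 : ∑' h : {h : Fin d → ℤ // h ≠ 0},
        ‖cubeFourierCoeff f h.1‖ * dualIndicator p z h.1 = 0 := by
      simp [fun h : {h : Fin d → ℤ // h ≠ 0} => hf0 h.1 h.2]
    rw [h2] at h1
    exact h1.trans (mul_nonneg (by positivity) (Real.sqrt_nonneg _))
  push Not at hf0
  obtain ⟨h0, hh0, hfh0⟩ := hf0
  set γ' : Finset (Fin d) → ℝ := fun u => γ u ^ (1 / lam) with hγ'
  have hγ'1 : ∀ u, 0 < γ' u ∧ γ' u ≤ 1 := fun u =>
    ⟨Real.rpow_pos_of_pos (hγ0 u) _, Real.rpow_le_one (hγ0 u).le (hγ u).2 (by positivity)⟩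
  have hβ : 1 < α / lam := (one_lt_div hlam0).2 hα
  set V := korobovV (α / lam) γ' with hVdef
  have hwt : ∀ h : Fin d → ℤ,
      1 / korobovWeight (α / lam) γ' h = korobovWeight α γ h ^ (-(1 / lam)) := by
    intro h
    have h1 := korobovWeight_rpow α (1 / lam) hγ0 h
    rw [mul_one_div] at h1
    rw [h1, Real.rpow_neg (hW h).le, one_div]
  have hV0 : 0 < V := (hγ'1 _).1.trans_le (le_korobovV hβ hγ'1 (freqSupport_nonempty hh0))
  have hV : HasSum (fun h : {h : Fin d → ℤ // h ≠ 0} =>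
      korobovWeight α γ h.1 ^ (-(1 / lam))) V := by
    simp only [← hwt]
    exact (summable_subtype_one_div_korobovWeight hβ hγ'1).hasSum
  -- Chain `|h_j|^lam ≤ |h_j|^α ≤ γ_u r(h)` with `γ_u ≤ V^lam`, where `u` is the support of `h`.
  have hVW : ∀ h : Fin d → ℤ, ∀ j, h j ≠ 0 →
      |(h j : ℝ)| ^ lam ≤ V ^ lam * korobovWeight α γ h := by
    intro h j hj
    have habs : 1 ≤ |(h j : ℝ)| := by exact_mod_cast Int.one_le_abs hj
    refine (Real.rpow_le_rpow_of_exponent_le habs hα.le).trans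
      ((abs_rpow_le_mul_korobovWeight (by linarith) hγ0 hj).trans ?_)
    refine mul_le_mul_of_nonneg_right ?_ (hW h).le
    have h1 := Real.rpow_le_rpow (hγ'1 (freqSupport h)).1.le
      (le_korobovV hβ hγ'1 (u := freqSupport h) ⟨j, by simp [freqSupport, hj]⟩) hlam0.le
    rwa [hγ', ← Real.rpow_mul (hγ0 _).le, one_div_mul_cancel hlam0.ne', Real.rpow_one] at h1
  have hF : 0 < korobovNorm α γ f :=
    Real.sqrt_pos.2 (hf.summable_sq.tsum_pos (fun h => by positivity) h0
      (mul_pos (pow_pos (hW h0) 2) (pow_pos (norm_pos_iff.2 hfh0) 2)))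
  set B₀ := (2 / (c * δ) + 2) * 64 ^ (lam - δ - 1 / 2) * V ^ lam *
    (n : ℝ) ^ (-lam - 1 / 2 + δ) * korobovNorm α γ f with hB₀
  have hB₀pos : 0 < B₀ := by positivity
  have hB : 16 * ((2 / (c * δ) + 2) * 64 ^ (lam - δ - 1 / 2)) * V ^ lam *
      (n : ℝ) ^ (-lam - 1 / 2 + δ) * korobovNorm α γ f = 16 * B₀ := by rw [hB₀]; ring
  simp only [hB]
  have hmeanX := latticeMean_tsum_cubeFourierCoeff_le hn hc (hcn n hn) hlam0 hδ
    (hδ'.le.trans (min_le_left _ _)) hγ0 hf hV0 hV hVW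
  rw [← hB₀] at hmeanX
  have hmeanS := latticeMean_tsum_one_div_korobovWeight_le hn hβ hγ'1 (d := d)
  simp only [hwt] at hmeanS
  rw [← hVdef] at hmeanS
  suffices h : 1 - latticeProb d n (fun p z =>
      ‖cubeIntegral f - latticeRule p z f‖ ≤ 16 * B₀) ≤ 1 / 8 by linarith
  rw [one_sub_latticeProb_eq d n hn]
  have hX0 : ∀ (p : ℕ) (z : Fin d → ℕ), 0 ≤ ∑' h : {h : Fin d → ℤ // h ≠ 0},
      (if (n / (64 * V)) ^ lam ≤ korobovWeight α γ h.1 then ‖cubeFourierCoeff f h.1‖ else 0) *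
        dualIndicator p z h.1 := fun p z => tsum_nonneg fun h =>
    mul_nonneg (by split_ifs <;> simp) (dualIndicator_nonneg p z h.1)
  have hS0 : ∀ (p : ℕ) (z : Fin d → ℕ), 0 ≤ ∑' h : {h : Fin d → ℤ // h ≠ 0},
      korobovWeight α γ h.1 ^ (-(1 / lam)) * dualIndicator p z h.1 := fun p z =>
    tsum_nonneg fun h =>
      mul_nonneg (Real.rpow_nonneg (hW h.1).le _) (dualIndicator_nonneg p z h.1)
  have hpt := latticeMean_mono (d := d) (n := n)
    (g := fun p z => if ‖cubeIntegral f - latticeRule p z f‖ ≤ 16 * B₀ then 0 else 1)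
    (g' := fun p z => n / (64 * V) * (∑' h : {h : Fin d → ℤ // h ≠ 0},
        korobovWeight α γ h.1 ^ (-(1 / lam)) * dualIndicator p z h.1) +
      1 / (16 * B₀) * ∑' h : {h : Fin d → ℤ // h ≠ 0},
        (if (n / (64 * V)) ^ lam ≤ korobovWeight α γ h.1 then ‖cubeFourierCoeff f h.1‖ else 0) *
          dualIndicator p z h.1) (by
      intro p hp z _
      have h1 := hX0 p z
      have h2 := hS0 p z
      split_ifs with hE
      · positivity
      · exact one_le_add_of_error_gt (mem_primeRange hn hp).1.one_lt.le hn hlam0 hγ0 hf hV0 hV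
          (by positivity) (not_le.1 hE) rfl h1 rfl)
  refine hpt.trans ?_
  rw [latticeMean_add, latticeMean_const_mul, latticeMean_const_mul]
  -- The factors 64 and 16 are chosen so that each of the two means contributes `1/16`.
  have e1 : n / (64 * V) * (4 * V / n) = 1 / 16 := by field_simp; norm_num
  have e2 : 1 / (16 * B₀) * B₀ = 1 / 16 := by field_simp
  have i1 := mul_le_mul_of_nonneg_left hmeanS (by positivity : 0 ≤ n / (64 * V))
  have i2 := mul_le_mul_of_nonneg_left hmeanX (by positivity : 0 ≤ 1 / (16 * B₀))
  rw [e1] at i1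
  rw [e2] at i2
  linarith
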